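/- **Setting.** Let $\ell\ge 1$, $L=2^\ell$ and $n\ge 2$. Three parties $P_1,P_2,P_3$ (indices cyclic) hold replicated secret sharings of numbers $a_1,\dots,a_n\in\mathbb Z_L$: a sharing $[\![x]\!]_m=(x_1,x_2,x_3)$ of $x\in\mathbb Z_m$ has $x_1+x_2+x_3\equiv x\pmod m$, and $P_i$ holds $(x_i,x_{i+1})$. Elements of $\mathbb Z_L$ represent signed integers in two's complement; write $\mathrm{int}(a)\in[-2^{\ell-1},2^{\ell-1})$ for the integer represented by $a$, and let $\mathrm{DReLU}(a)=1$ if $\mathrm{int}(a)\ge 0$ and $0$ otherwise, $\mathrm{ReLU}(a)=\mathrm{DReLU}(a)\cdot a$. The inputs are assumed to be consistently shared and such that comparisons do not overflow: $|\mathrm{int}(a_i)-\mathrm{int}(a_j)|<2^{\ell-1}$ for all $i,j$. **Functionalities.** Each functionality receives the sharings held by the parties, and aborts if some party gives no input or if the parties' common components disagree. Otherwise it generates fresh uniformly random (mutually independent) sharings of its outputs; the corrupted party gets its part first and then decides whether the honest parties get their parts or all of them get $\mathsf{Abort}$. * $\mathcal F_{\mathsf{Mult}}$: from $[\![x]\!]_L,[\![y]\!]_L$,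 shares of $xy$ modulo $L$. * $\mathcal F_{\mathsf{ReLU}}$: from $[\![a]\!]_L$, shares of $\mathrm{ReLU}(a)$ modulo $L$ or, on the command DReLU, shares of the bit $\mathrm{DReLU}(a)$ modulo $2$. * $\mathcal F_{\mathsf{Prep}}$ (no input): shares $[\![c]\!]_2$ and $[\![c]\!]_L$ of a uniformly random bit $c$. * $\mathcal F_{\mathsf{Maxpool}}$: from $[\![a_1]\!]_L,\dots,[\![a_n]\!]_L$, shares modulo $L$ of $a_k$ and of each entry of the one-hot vector $\mathbf e_k\in\{0,1\}^n$, where $k=\operatorname{argmax}_j \mathrm{int}(a_j)$ (the smallest such index in case of a tie). **Protocol $\Pi_{\mathsf{Maxpool}}$.** Linear operations are local, and a public constant $v$ is shared as $(v,0,0)$. Start with $\mathsf{max}=a_1$, $\mathsf{ind}=\mathbf e_1$. For $i=2,\dots,n$: get $[\![b]\!]_2$ with $b=\mathrm{DReLU}(\mathsf{max}-a_i)$ from $\mathcal F_{\mathsf{ReLU}}$; set $\mathsf{max}\leftarrow\mathsf{SS}(a_i,\mathsf{max},b)$ and, entry by entry, $\mathsf{ind}\leftarrow\mathsf{SS}(\mathbf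 e_i,\mathsf{ind},b)$. Return $\mathsf{max},\mathsf{ind}$. Here $\mathsf{SS}(x,y,b)$ gets $[\![c]\!]_2,[\![c]\!]_L$ from $\mathcal F_{\mathsf{Prep}}$, opens $e=b\oplus c$, sets $d=1-c$ if $e=1$ and $d=c$ otherwise, and returns $[\![(y-x)d]\!]_L+[\![x]\!]_L$, the product coming from $\mathcal F_{\mathsf{Mult}}$. To open a sharing, $P_i$ sends $x_i$ to $P_{i+1}$ and $x_{i+1}$ to $P_{i-1}$, and aborts if the two values it receives differ or one is missing. A party that gets $\mathsf{Abort}$ from a functionality aborts. **Theorem.** $\Pi_{\mathsf{Maxpool}}$ securely realizes $\mathcal F_{\mathsf{Maxpool}}$ with abort, in the presence of one malicious party, in the $(\mathcal F_{\mathsf{Mult}},\mathcal F_{\mathsf{ReLU}},\mathcal F_{\mathsf{Prep}})$-hybrid model, with perfect security and a straight-line black-box simulator. That is: for each corrupted party $P_c$ there is a simulator $\mathcal S$, which is given the input of $P_c$ and oracle access to the adversary (without rewinding) and plays the role of $P_c$ towards $\mathcal F_{\mathsf{Maxpool}}$, such that for all inputs as above and every (computationally unbounded, randomized, rushing, arbitrarily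 deviating) adversary $\mathcal A$ corrupting $P_c$, the joint distribution of the outputs of the two honest parties and of the final state of $\mathcal A$ is exactly the same in the hybrid-model execution of $\Pi_{\mathsf{Maxpool}}$ with $\mathcal A$ and in the ideal execution with $\mathcal F_{\mathsf{Maxpool}}$, the honest parties forwarding their inputs to $\mathcal F_{\mathsf{Maxpool}}$, and $\mathcal S$ interacting with $\mathcal A$. -/

import Mathlib

noncomputable section

namespace Falcon

/-! ## Functionalities for three parties

The parties are the elements of `Fin 3`; the party after `i` is `i + 1`, the party before `i` is
`i + 2`. -/

/-- A (non-reactive) three-party ideal functionality: from the inputs of the parties it draws the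
outputs of the parties, or it aborts (`none`). -/
structure Functionality where
  In : Type
  Out : Type
  eval : (Fin 3 → In) → PMF (Option (Fin 3 → Out))

open Classical in
/-- Activation of a functionality; a party that has aborted, or that refuses to give an input,
contributes `none`, and then the functionality aborts. -/
def Functionality.activate (F : Functionality) (x : Fin 3 → Option F.In) :
    PMF (Option (Fin 3 → F.Out)) :=
  if h : ∀ i, (x i).isSome = true then F.eval (fun i => (x i).get (h i)) else PMF.pure none

/-- The family of values whose entries at `c`, `c + 1`, `c + 2` are `u`, `v`, `w`. -/
def arrange {α : Type} (c : Fin 3) (u v w : α) : Fin 3 → α :=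
  fun i => if i = c then u else if i = c + 1 then v else w

/-! ## Interactive probabilistic programs with oracle access to an adversary -/

/-- A program that may query an oracle (queries `Q`, answers `R q`) and toss coins. There is no
instruction that resets the oracle, so such a program cannot rewind it. -/
inductive Oracle (Q : Type) (R : Q → Type) (α : Type) : Type 1
  | ret (a : α) : Oracle Q R α
  | query (q : Q) (k : R q → Oracle Q R α) : Oracle Q R α
  | draw {β : Type} (p : PMF β) (k : β → Oracle Q R α) : Oracle Q R α

/-- Sequential composition. -/
def Oracle.andThen {Q : Type} {R : Q → Type} {α β : Type} (f : α → Oracle Q R β) :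
    Oracle Q R α → Oracle Q R β
  | .ret a => f a
  | .query q k => .query q (fun r => (k r).andThen f)
  | .draw p k => .draw p (fun b => (k b).andThen f)

instance (Q : Type) (R : Q → Type) : Monad (Oracle Q R) where
  pure := Oracle.ret
  bind p f := p.andThen f

/-- Ask one query and return the answer. -/
def Oracle.ask {Q : Type} {R : Q → Type} (q : Q) : Oracle Q R (R q) := .query q .ret

/-- Toss coins once. -/
def Oracle.toss {Q : Type} {R : Q → Type} {β : Type} (p : PMF β) : Oracle Q R β := .draw p .ret

/-! ## Protocols in a hybrid model -/

/-- The program of one party in the hybrid model with functionalities `H f`, `f : ι`, and private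
pairwise channels carrying messages in `M`. A party can stop with an output, abort, call a
functionality with its input (and continue with the output it gets), or take part in a synchronous
round in which it sends one message to the next and one to the previous party and continues with
the messages received from the next and from the previous party. -/
inductive Prog {ι : Type} (H : ι → Functionality) (M α : Type) : Type
  | ret (a : α) : Prog H M α
  | abort : Prog H M α
  | call (f : ι) (x : (H f).In) (k : (H f).Out → Prog H M α) : Prog H M α
  | exch (toNext toPrev : M) (k : (fromNext fromPrev : M) → Prog H M α) : Prog H M α

/-- Sequential composition. -/
def Prog.andThen {ι : Type} {H : ι → Functionality} {M α β : Type} (f : α → Prog H M β) :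
    Prog H M α → Prog H M β
  | .ret a => f a
  | .abort => .abort
  | .call g x k => .call g x (fun y => (k y).andThen f)
  | .exch u v k => .exch u v (fun s t => (k s t).andThen f)

instance {ι : Type} (H : ι → Functionality) (M : Type) : Monad (Prog H M) where
  pure := Prog.ret
  bind p f := p.andThen f

/-- Run a family of programs one after the other and collect the results. -/
def Prog.forFin {ι : Type} {H : ι → Functionality} {M α : Type} :
    (n : ℕ) → (Fin n → Prog H M α) → Prog H M (Fin n → α)
  | 0, _ => .ret Fin.elim0
  | n + 1, f => do
      let a ← f 0
      let as ← Prog.forFin n (fun i => f i.succ)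
      .ret (Fin.cons a as)

/-! ## The malicious adversary and the real execution -/

/-- What happens to the corrupted party during an execution in the hybrid model:
it is asked for its input to a functionality; it gets its output from a functionality (`none` if
the functionality has aborted) and is asked whether the honest parties shall get theirs; it gets
the messages of the next and the previous party in a round and is asked for its own messages of
that round (it is rushing). -/
inductive Event {ι : Type} (H : ι → Functionality) (M : Type) : Type
  | input (f : ι) : Event H M
  | output (f : ι) (y : Option (H f).Out) : Event H M
  | round (fromNext fromPrev : Option M) : Event H M

/-- The possible reactions: an input or none; deliver (`true`) or abort (`false`); a message or
none for the next and for the previous party. -/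
def Reaction {ι : Type} (H : ι → Functionality) (M : Type) : Event H M → Type
  | .input f => Option (H f).In
  | .output _ _ => Bool
  | .round _ _ => Option M × Option M

/-- An arbitrary, computationally unbounded, randomized, stateful strategy of the corrupted
party, started on the input of that party (of type `X`). -/
structure Adversary {ι : Type} (H : ι → Functionality) (M X : Type) where
  State : Type
  start : X → State
  react : (e : Event H M) → State → PMF (Reaction H M e × State)

/-- Run an oracle program against the adversary: joint distribution of the result of the program
and the final state of the adversary. -/
def Oracle.run {ι : Type} {H : ι → Functionality} {M X α : Type} (A : Adversary H M X) :
    Oracle (Event H M) (Reaction H M) α → A.State → PMF (α × A.State)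
  | .ret a, s => PMF.pure (a, s)
  | .query e k, s => (A.react e s).bind (fun r => (k r.1).run A r.2)
  | .draw p k, s => p.bind (fun b => (k b).run A s)

/-- A call of the functionality `H f` with abort when party `c` is corrupted and parties `c + 1`,
`c + 2` contribute `x`, `y`: the corrupted party gets its output first and then decides whether the
honest parties get theirs or all of them get `none`. -/
def callHybrid {ι : Type} {H : ι → Functionality} {M : Type} (c : Fin 3) (f : ι)
    (x y : Option (H f).In) :
    Oracle (Event H M) (Reaction H M) (Option (Fin 3 → (H f).Out)) := do
  let z ← Oracle.ask (R := Reaction H M) (.input f)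
  let out ← Oracle.toss ((H f).activate (arrange c z x y))
  let deliver : Bool ← Oracle.ask (R := Reaction H M) (.output f (out.map (fun o => o c)))
  .ret (if deliver = true then out else none)

/-- Execution when party `c` is corrupted, one honest party has stopped and the program of the other
one is given; `isNext` says whether the latter is the party after `c` (or the one before).
An honest party that does not get an output or a message that it waits for aborts. -/
def runAlone {ι : Type} {H : ι → Functionality} {M α : Type} (c : Fin 3) (isNext : Bool) :
    Prog H M α → Oracle (Event H M) (Reaction H M) (Option α)
  | .ret a => .ret (some a)
  | .abort => .ret none
  | .call f x _ => do
      let _ ← callHybrid (M := M) c f (if isNext = true then some x else none)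
        (if isNext = true then none else some x)
      .ret none
  | .exch toNext toPrev _ => do
      let _ ← Oracle.ask (R := Reaction H M)
        (if isNext = true then .round (some toPrev) none else .round none (some toNext))
      .ret none

open Classical in
/-- Joint execution of the programs of the honest parties `c + 1` and `c + 2` (in this order) when
party `c` is corrupted; the result is the pair of their outputs, `none` standing for abort. -/
def runHonest {ι : Type} {H : ι → Functionality} {M α : Type} (c : Fin 3) :
    Prog H M α → Prog H M α → Oracle (Event H M) (Reaction H M) (Option α × Option α)
  | .ret a, q => do
      let b ← runAlone c false q
      .ret (some a, b)
  | .abort, q => do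
      let b ← runAlone c false q
      .ret (none, b)
  | .call f x k, .call g y l =>
      if h : g = f then do
        let out ← callHybrid (M := M) c f (some x) (some (h ▸ y))
        match out with
        | none => .ret (none, none)
        | some o => runHonest c (k (o (c + 1))) (l (h ▸ o (c + 2)))
      else .ret (none, none)
  | .exch toNext toPrev k, .exch toNext₂ toPrev₂ l => do
      let r ← Oracle.ask (R := Reaction H M) (.round (some toPrev) (some toNext₂))
      match r with
      | (some u, some v) => runHonest c (k toPrev₂ u) (l v toNext)
      | (some u, none) => do
          let a ← runAlone c true (k toPrev₂ u)
          .ret (a, none)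
      | (none, some v) => do
          let b ← runAlone c false (l v toNext)
          .ret (none, b)
      | (none, none) => .ret (none, none)
  | p, .ret b => do
      let a ← runAlone c true p
      .ret (a, some b)
  | p, .abort => do
      let a ← runAlone c true p
      .ret (a, none)
  | _, _ => .ret (none, none)

/-! ## The ideal execution and security with abort -/

/-- A straight-line black-box simulator for the functionality `F` with abort. Given the input of the
corrupted party and oracle access to the adversary (without rewinding), it chooses an input for `F`
(or none, which makes `F` abort), gets the output of the corrupted party from `F`, continues to
interact with the adversary, and finally decides whether the honest parties get their outputs. -/
structure Simulator {ι : Type} (H : ι → Functionality) (M : Type) (F : Functionality) where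
  Memory : Type
  choose : F.In → Oracle (Event H M) (Reaction H M) (Option F.In × Memory)
  finish : Memory → Option F.Out → Oracle (Event H M) (Reaction H M) Bool

/-- The ideal execution with corrupted party `c`: the honest parties forward their inputs to `F` and
output what they get from it. -/
def idealExec {ι : Type} {H : ι → Functionality} {M : Type} {F : Functionality}
    (S : Simulator H M F) (c : Fin 3) (x : Fin 3 → F.In) :
    Oracle (Event H M) (Reaction H M) (Option F.Out × Option F.Out) := do
  let zm ← S.choose (x c)
  let out ← Oracle.toss (F.activate (arrange c zm.1 (some (x (c + 1))) (some (x (c + 2)))))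
  let deliver ← S.finish zm.2 (out.map (fun o => o c))
  .ret (if deliver = true then (out.map (fun o => o (c + 1)), out.map (fun o => o (c + 2)))
    else (none, none))

/-- The protocol `π` (`π i x` is the program of party `i` on input `x`) securely realizes `F` with
abort, in the presence of one malicious party, in the hybrid model of the functionalities `H`, on
the input families satisfying `Adm`. Security is perfect and the simulator is straight-line
black-box: for each corrupted party there is a simulator such that, for all admissible inputs and
all adversaries, the joint distributions of the outputs of the honest parties and of the final state
of the adversary in the real and in the ideal execution are equal. -/
def SecurelyRealizesWithAbort {ι : Type} {H : ι → Functionality} {M : Type} (F : Functionality)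
    (π : Fin 3 → F.In → Prog H M F.Out) (Adm : (Fin 3 → F.In) → Prop) : Prop :=
  ∀ c : Fin 3, ∃ S : Simulator H M F, ∀ x : Fin 3 → F.In, Adm x →
    ∀ A : Adversary H M F.In,
      (runHonest c (π (c + 1) (x (c + 1))) (π (c + 2) (x (c + 2)))).run A (A.start (x c)) =
        (idealExec S c x).run A (A.start (x c))

/-! ## Replicated secret sharing -/

/-- What one party holds of a 2-out-of-3 replicated sharing modulo `m`: party `i` holds the
components `i` and `i + 1`. The ring operations are componentwise. -/
abbrev Sh (m : ℕ) : Type := ZMod m × ZMod m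

/-- The part of the sharing with components `s` held by party `i`. -/
def held {m : ℕ} (s : Fin 3 → ZMod m) (i : Fin 3) : Sh m := (s i, s (i + 1))

/-- The parties agree on the common components. -/
def Consistent {m : ℕ} (x : Fin 3 → Sh m) : Prop := ∀ i, (x i).2 = (x (i + 1)).1

/-- The shared value. -/
def secret {m : ℕ} (x : Fin 3 → Sh m) : ZMod m := (x 0).1 + (x 1).1 + (x 2).1

/-- The part held by party `i` of the sharing `(v, 0, 0)` of a public constant `v`. -/
def pub {m : ℕ} (i : Fin 3) (v : ZMod m) : Sh m := held ![v, 0, 0] i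

/-- The sharing of `v` with first two components `r`. -/
def shareWith {m : ℕ} (r : ZMod m × ZMod m) (v : ZMod m) : Fin 3 → Sh m :=
  held ![r.1, r.2, v - r.1 - r.2]

/-- Uniformly random sharing of `v`. -/
def randomShares {m : ℕ} [NeZero m] (v : ZMod m) : PMF (Fin 3 → Sh m) :=
  (PMF.uniformOfFintype (ZMod m × ZMod m)).map (fun r => shareWith r v)

/-- Independent uniformly random sharings of the entries of a vector `v`. -/
def randomSharesVec {m n : ℕ} [NeZero m] (v : Fin n → ZMod m) : PMF (Fin 3 → Fin n → Sh m) :=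
  (PMF.uniformOfFintype (Fin n → ZMod m × ZMod m)).map (fun r i j => shareWith (r j) (v j) i)

/-! ## Signed numbers modulo `2 ^ ℓ` -/

/-- The signed integer represented by a residue (two's complement). -/
def toSigned {ℓ : ℕ} (a : ZMod (2 ^ ℓ)) : ℤ :=
  if a.val < 2 ^ (ℓ - 1) then (a.val : ℤ) else (a.val : ℤ) - 2 ^ ℓ

/-- Derivative of ReLU: `1 - MSB`. -/
def dReLU {ℓ : ℕ} (a : ZMod (2 ^ ℓ)) : ZMod 2 := if a.val < 2 ^ (ℓ - 1) then 1 else 0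

/-- ReLU. -/
def reLU {ℓ : ℕ} (a : ZMod (2 ^ ℓ)) : ZMod (2 ^ ℓ) := if a.val < 2 ^ (ℓ - 1) then a else 0

/-- The set of positions of the maximum. -/
def maximizers {n : ℕ} (a : Fin n → ℤ) : Finset (Fin n) :=
  Finset.univ.filter (fun k => ∀ j, a j ≤ a k)

theorem maximizers_nonempty {n : ℕ} [NeZero n] (a : Fin n → ℤ) : (maximizers a).Nonempty := by
  obtain ⟨k, hk⟩ := Finite.exists_max a
  exact ⟨k, by simpa [maximizers] using hk⟩

/-- The position of the maximum (the first one in case of a tie). -/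
def argmax {n : ℕ} [NeZero n] (a : Fin n → ℤ) : Fin n :=
  (maximizers a).min' (maximizers_nonempty a)

/-- The one-hot vector with its one at position `k`. -/
def oneHot {m n : ℕ} (k : Fin n) : Fin n → ZMod m := fun j => if j = k then 1 else 0

/-! ## The functionalities -/

open Classical in
/-- Multiplication modulo `2 ^ ℓ`: fresh random shares of the product of two shared values. -/
def FMult (ℓ : ℕ) : Functionality where
  In := Sh (2 ^ ℓ) × Sh (2 ^ ℓ)
  Out := Sh (2 ^ ℓ)
  eval x :=
    if Consistent (fun i => (x i).1) ∧ Consistent (fun i => (x i).2) then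
      (randomShares (secret (fun i => (x i).1) * secret (fun i => (x i).2))).map some
    else PMF.pure none

open Classical in
/-- ReLU: fresh random shares modulo `2 ^ ℓ` of ReLU of a shared value. -/
def FReLU (ℓ : ℕ) : Functionality where
  In := Sh (2 ^ ℓ)
  Out := Sh (2 ^ ℓ)
  eval x := if Consistent x then (randomShares (reLU (secret x))).map some else PMF.pure none

open Classical in
/-- Derivative of ReLU: fresh random shares modulo `2` of the bit DReLU of a shared value. -/
def FDReLU (ℓ : ℕ) : Functionality where
  In := Sh (2 ^ ℓ)
  Out := Sh 2
  eval x := if Consistent x then (randomShares (dReLU (secret x))).map some else PMF.pure none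

/-- Preprocessing: fresh random shares of a uniformly random bit, modulo `2` and modulo `2 ^ ℓ`. -/
def FPrep (ℓ : ℕ) : Functionality where
  In := Unit
  Out := Sh 2 × Sh (2 ^ ℓ)
  eval _ :=
    (PMF.uniformOfFintype (ZMod 2)).bind fun c =>
      (randomShares c).bind fun s =>
        (randomShares (c.val : ZMod (2 ^ ℓ))).map fun t => some fun i => (s i, t i)

open Classical in
/-- Maxpool: fresh random shares of the maximum and of the one-hot vector of its position. -/
def FMaxpool (ℓ n : ℕ) [NeZero n] : Functionality where
  In := Fin n → Sh (2 ^ ℓ)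
  Out := Sh (2 ^ ℓ) × (Fin n → Sh (2 ^ ℓ))
  eval x :=
    if ∀ j, Consistent (fun i => x i j) then
      let a : Fin n → ZMod (2 ^ ℓ) := fun j => secret (fun i => x i j)
      let k : Fin n := argmax (fun j => toSigned (a j))
      (randomShares (a k)).bind fun s =>
        (randomSharesVec (oneHot k)).map fun t => some fun i => (s i, t i)
    else PMF.pure none

/-! ## The Maxpool protocol -/

/-- The functionalities of the hybrid model; the one for ReLU also has the command DReLU. -/
inductive Cmd : Type
  | mult | relu | drelu | prep

/-- The functionalities of the hybrid model. -/
def hybrid (ℓ : ℕ) : Cmd → Functionality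
  | .mult => FMult ℓ
  | .relu => FReLU ℓ
  | .drelu => FDReLU ℓ
  | .prep => FPrep ℓ

/-- Programs in the hybrid model; the messages between the parties are bits. -/
abbrev Party (ℓ : ℕ) (α : Type) : Type := Prog (hybrid ℓ) (ZMod 2) α

def mult {ℓ : ℕ} (x y : Sh (2 ^ ℓ)) : Party ℓ (Sh (2 ^ ℓ)) :=
  Prog.call (H := hybrid ℓ) Cmd.mult (x, y) (fun z : Sh (2 ^ ℓ) => .ret z)

def drelu {ℓ : ℕ} (x : Sh (2 ^ ℓ)) : Party ℓ (Sh 2) :=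
  Prog.call (H := hybrid ℓ) Cmd.drelu x (fun z : Sh 2 => .ret z)

def prep {ℓ : ℕ} : Party ℓ (Sh 2 × Sh (2 ^ ℓ)) :=
  Prog.call (H := hybrid ℓ) Cmd.prep () (fun z : Sh 2 × Sh (2 ^ ℓ) => .ret z)

/-- Reconstruction of a shared bit: party `i` sends component `i` to the next and component `i + 1`
to the previous party, and aborts if the two values that it receives differ. -/
def openBit {ℓ : ℕ} (x : Sh 2) : Party ℓ (ZMod 2) :=
  .exch x.1 x.2 (fun fromNext fromPrev =>
    if fromNext = fromPrev then .ret (x.1 + x.2 + fromPrev) else .abort)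

/-- Select shares: party `i` gets its part of a sharing of `x` if `b = 0` and of `y` if `b = 1`. -/
def selectShares {ℓ : ℕ} (i : Fin 3) (x y : Sh (2 ^ ℓ)) (b : Sh 2) : Party ℓ (Sh (2 ^ ℓ)) := do
  let c ← prep
  let e ← openBit (b + c.1)
  let d : Sh (2 ^ ℓ) := if e = 1 then pub i 1 - c.2 else c.2
  let z ← mult (y - x) d
  .ret (z + x)

/-- The loop of the Maxpool protocol over a list of positions, for party `i`. -/
def maxpoolLoop {ℓ n : ℕ} (i : Fin 3) (a : Fin n → Sh (2 ^ ℓ)) :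
    List (Fin n) → Sh (2 ^ ℓ) → (Fin n → Sh (2 ^ ℓ)) →
      Party ℓ (Sh (2 ^ ℓ) × (Fin n → Sh (2 ^ ℓ)))
  | [], max, ind => .ret (max, ind)
  | j :: js, max, ind => do
      let b ← drelu (max - a j)
      let max₂ ← selectShares i (a j) max b
      let ind₂ ← Prog.forFin n (fun t => selectShares i (pub i (oneHot j t)) (ind t) b)
      maxpoolLoop i a js max₂ ind₂

/-- The Maxpool protocol for party `i` with its parts `a` of the sharings of the inputs. -/
def maxpool {ℓ n : ℕ} [NeZero n] (i : Fin 3) (a : Fin n → Sh (2 ^ ℓ)) :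
    Party ℓ (Sh (2 ^ ℓ) × (Fin n → Sh (2 ^ ℓ))) :=
  maxpoolLoop i a (List.finRange n).tail (a 0) (fun t => pub i (oneHot 0 t))

/-- The parties hold consistent sharings of numbers whose pairwise differences do not overflow the
signed range. -/
def Admissible {ℓ n : ℕ} (x : Fin 3 → Fin n → Sh (2 ^ ℓ)) : Prop :=
  (∀ j, Consistent (fun i => x i j)) ∧
    ∀ j k, |toSigned (secret (fun i => x i j)) - toSigned (secret (fun i => x i k))| < 2 ^ (ℓ - 1)

end Falcon

end

noncomputable section

namespace Falcon

/-! ## Indistinguishable oracle programs -/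

section Same

variable {ι : Type} {H : ι → Functionality} {M α β γ : Type}

/-! A consistent replicated sharing is determined by its secret and the part `w` of one party: this
is `complete c w v`. Two facts follow. By `randomShares_eq`, a fresh random sharing of `v` amounts
to a uniform part `w` for the corrupted party, whatever `v` is, so a simulator can draw `w` without
knowing any secret. By `consistent_arrange_iff`, the parts of the two honest parties already fix
both components of the corrupted one, so a functionality accepts exactly one input from it, and that
input is computable from its view. Cheating in a call can therefore only cause an abort
(`runHonest_call`), and no input has to be extracted: the simulator submits the prescribed one at
once.

The only value that is opened is `e = b + c`. Since `c` is a fresh uniform bit, so is `e`, and the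
simulator draws it directly. A false or missing message in the opening is noticed by the honest
party concerned, which holds or has received the true component from the other side
(`runHonest_openBit`). For `selectShares` the coins are then reparametrized: `e` replaces `c`, and
the corrupted party's final part `w` replaces its part `w - wx` of the product
(`runHonest_selectShares`).

Consequently the parts that the corrupted party holds at the end are uniform and may be drawn before
the whole interaction. In the ideal world they come from the Maxpool functionality, and the
simulator steers the last round towards them. Both worlds thus equal one program, `simulatedExec`.
All rearrangements take place in the congruence `Same`, under which independent coins commute with
interaction and unused coins disappear.

It remains that the protocol computes the right values: without overflow, `dReLU` of a difference
compares signed integers (`dReLU_sub`), and the scan from left to right keeps the earlier position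
in a tie, as `argmax` does (`scan_spec`, `loopValue_eq`). -/

/-- Two oracle programs have the same behaviour with every adversary. -/
def Same (p q : Oracle (Event H M) (Reaction H M) α) : Prop :=
  ∀ (X : Type) (A : Adversary H M X) (s : A.State), p.run A s = q.run A s

theorem Same.refl (p : Oracle (Event H M) (Reaction H M) α) : Same p p := fun _ _ _ => rfl

theorem Same.symm {p q : Oracle (Event H M) (Reaction H M) α} (h : Same p q) : Same q p :=
  fun X A s => (h X A s).symm

theorem Same.trans {p q r : Oracle (Event H M) (Reaction H M) α} (h : Same p q) (h' : Same q r) :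
    Same p r := fun X A s => (h X A s).trans (h' X A s)

theorem Same.of_eq {p q : Oracle (Event H M) (Reaction H M) α} (h : p = q) : Same p q :=
  h ▸ Same.refl p

theorem Same.query {e : Event H M} {k l : Reaction H M e → Oracle (Event H M) (Reaction H M) α}
    (h : ∀ r, Same (k r) (l r)) : Same (.query e k) (.query e l) := by
  intro X A s
  simp only [Oracle.run]
  congr 1
  funext r
  exact h _ X A _

theorem Same.draw {μ : PMF β} {k l : β → Oracle (Event H M) (Reaction H M) α}
    (h : ∀ b, Same (k b) (l b)) : Same (.draw μ k) (.draw μ l) := by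
  intro X A s
  simp only [Oracle.run]
  congr 1
  funext r
  exact h _ X A _

theorem run_andThen {X : Type} (A : Adversary H M X) (f : α → Oracle (Event H M) (Reaction H M) β)
    (p : Oracle (Event H M) (Reaction H M) α) (s : A.State) :
    (p.andThen f).run A s = (p.run A s).bind (fun r => (f r.1).run A r.2) := by
  induction p generalizing s with
  | ret a => simp [Oracle.andThen, Oracle.run, PMF.pure_bind]
  | query e k ih =>
    simp only [Oracle.andThen, Oracle.run, PMF.bind_bind]
    congr 1
    funext r
    exact ih _ _
  | draw μ k ih =>
    simp only [Oracle.andThen, Oracle.run, PMF.bind_bind]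
    congr 1
    funext r
    exact ih _ _

theorem Same.andThen {p q : Oracle (Event H M) (Reaction H M) α}
    {f g : α → Oracle (Event H M) (Reaction H M) β}
    (h : Same p q) (h' : ∀ a, Same (f a) (g a)) : Same (p.andThen f) (q.andThen g) := by
  intro X A s
  rw [run_andThen, run_andThen, h X A s]
  congr 1
  funext r
  exact h' _ X A _

theorem Oracle.andThen_assoc {Q : Type} {R : Q → Type} (p : Oracle Q R α) (f : α → Oracle Q R β)
    (g : β → Oracle Q R γ) : (p.andThen f).andThen g = p.andThen (fun a => (f a).andThen g) := by
  induction p with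
  | ret a => rfl
  | query e k ih => simp only [Oracle.andThen, ih]
  | draw μ k ih => simp only [Oracle.andThen, ih]

/-- Needed on aborting branches: the output part drawn in advance is never used there, and its coins
may be added or removed. -/
theorem Same.draw_const (μ : PMF β) (p : Oracle (Event H M) (Reaction H M) α) :
    Same (.draw μ (fun _ => p)) p := by
  intro X A s
  simp only [Oracle.run, PMF.bind_const]

theorem Same.draw_comm (μ : PMF β) (ν : PMF γ)
    (k : β → γ → Oracle (Event H M) (Reaction H M) α) :
    Same (.draw μ (fun b => .draw ν (fun c => k b c)))
      (.draw ν (fun c => .draw μ (fun b => k b c))) := by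
  intro X A s
  simp only [Oracle.run]
  exact PMF.bind_comm _ _ _

/-- The coins depend neither on `p` nor on the adversary's reactions, so Fubini allows tossing them
before the interaction. This is what lets output parts be drawn in advance. -/
theorem Same.draw_andThen (μ : PMF γ) (p : Oracle (Event H M) (Reaction H M) α)
    (f : γ → α → Oracle (Event H M) (Reaction H M) β) :
    Same (p.andThen (fun a => .draw μ (fun c => f c a))) (.draw μ (fun c => p.andThen (f c))) := by
  intro X A s
  simp only [run_andThen, Oracle.run]
  exact PMF.bind_comm _ _ _

theorem Same.draw_query (μ : PMF β) (e : Event H M)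
    (k : β → Reaction H M e → Oracle (Event H M) (Reaction H M) α) :
    Same (.query e (fun r => .draw μ (fun b => k b r))) (.draw μ (fun b => .query e (k b))) := by
  intro X A s
  simp only [Oracle.run]
  exact PMF.bind_comm _ _ _

theorem Same.draw_bind (μ : PMF β) (ν : β → PMF γ)
    (k : γ → Oracle (Event H M) (Reaction H M) α) :
    Same (.draw (μ.bind ν) k) (.draw μ (fun b => .draw (ν b) k)) := by
  intro X A s
  simp only [Oracle.run, PMF.bind_bind]

theorem Same.draw_map (μ : PMF β) (f : β → γ)
    (k : γ → Oracle (Event H M) (Reaction H M) α) :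
    Same (.draw (μ.map f) k) (.draw μ (fun b => k (f b))) := by
  intro X A s
  simp only [Oracle.run, PMF.bind_map]
  rfl

theorem Same.draw_pure (b : β) (k : β → Oracle (Event H M) (Reaction H M) α) :
    Same (.draw (PMF.pure b) k) (k b) := by
  intro X A s
  simp only [Oracle.run, PMF.pure_bind]

theorem map_uniformOfFintype_equiv [Fintype β] [Nonempty β] [Fintype γ] [Nonempty γ] (e : β ≃ γ) :
    (PMF.uniformOfFintype β).map e = PMF.uniformOfFintype γ := by
  ext c
  rw [PMF.map_apply, tsum_eq_single (e.symm c)]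
  · simp [Fintype.card_congr e]
  · intro b hb
    rw [if_neg]
    rintro rfl
    simp at hb

/-- Change of variables for uniform coins. -/
theorem Same.draw_equiv [Fintype β] [Nonempty β] [Fintype γ] [Nonempty γ] (e : β ≃ γ)
    (k : γ → Oracle (Event H M) (Reaction H M) α) :
    Same (.draw (PMF.uniformOfFintype β) (fun b => k (e b)))
      (.draw (PMF.uniformOfFintype γ) k) := by
  rw [← map_uniformOfFintype_equiv e]
  exact (Same.draw_map _ _ _).symm

theorem uniformOfFintype_prod [Fintype β] [Nonempty β] [Fintype γ] [Nonempty γ] :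
    PMF.uniformOfFintype (β × γ) =
      (PMF.uniformOfFintype β).bind fun b => (PMF.uniformOfFintype γ).map fun c => (b, c) := by
  ext ⟨b, c⟩
  rw [PMF.bind_apply, tsum_eq_single b]
  · rw [PMF.map_apply, tsum_eq_single c]
    · simp only [PMF.uniformOfFintype_apply, Fintype.card_prod, if_true]
      rw [Nat.cast_mul, ENNReal.mul_inv] <;> simp
    · intro c' h
      rw [if_neg]
      rintro ⟨⟩
      exact h rfl
  · intro b' h
    rw [PMF.map_apply]
    simp only [mul_eq_zero]
    right
    simp only [ENNReal.tsum_eq_zero]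
    intro c'
    rw [if_neg]
    rintro ⟨⟩
    exact h rfl

theorem Same.draw_prod [Fintype β] [Nonempty β] [Fintype γ] [Nonempty γ]
    (k : β × γ → Oracle (Event H M) (Reaction H M) α) :
    Same (.draw (PMF.uniformOfFintype (β × γ)) k)
      (.draw (PMF.uniformOfFintype β) fun b => .draw (PMF.uniformOfFintype γ) fun c => k (b, c)) := by
  rw [uniformOfFintype_prod]
  exact (Same.draw_bind _ _ _).trans (Same.draw fun b => Same.draw_map _ _ _)

theorem Same.draw_cons {n : ℕ} [Fintype β] [Nonempty β]
    (k : (Fin (n + 1) → β) → Oracle (Event H M) (Reaction H M) α) :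
    Same (.draw (PMF.uniformOfFintype (Fin (n + 1) → β)) k)
      (.draw (PMF.uniformOfFintype β) fun b =>
        .draw (PMF.uniformOfFintype (Fin n → β)) fun w => k (Fin.cons b w)) :=
  (Same.draw_equiv (Fin.consEquiv (fun _ : Fin (n + 1) => β)) k).symm.trans (Same.draw_prod _)

end Same

/-! ## Sharings given by the part of one party and the secret -/

section Complete

variable {m : ℕ}

/-- The sharing of `v` in which party `c` holds `w`. -/
def complete (c : Fin 3) (w : Sh m) (v : ZMod m) : Fin 3 → Sh m :=
  held (arrange c w.1 w.2 (v - w.1 - w.2))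

theorem complete_self (c : Fin 3) (w : Sh m) (v : ZMod m) : complete c w v c = w := by
  fin_cases c <;> rfl

theorem complete_next (c : Fin 3) (w : Sh m) (v : ZMod m) :
    complete c w v (c + 1) = (w.2, v - w.1 - w.2) := by
  fin_cases c <;> rfl

theorem complete_prev (c : Fin 3) (w : Sh m) (v : ZMod m) :
    complete c w v (c + 2) = (v - w.1 - w.2, w.1) := by
  fin_cases c <;> rfl

theorem fin3_cases (c i : Fin 3) : i = c ∨ i = c + 1 ∨ i = c + 2 := by
  revert c i; decide

theorem family_ext {α : Type} (c : Fin 3) {x y : Fin 3 → α} (h : x c = y c)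
    (h₁ : x (c + 1) = y (c + 1)) (h₂ : x (c + 2) = y (c + 2)) : x = y := by
  funext i
  rcases fin3_cases c i with rfl | rfl | rfl <;> assumption

theorem arrange_self {α : Type} (c : Fin 3) (u v w : α) : arrange c u v w c = u := by
  fin_cases c <;> rfl

theorem arrange_next {α : Type} (c : Fin 3) (u v w : α) : arrange c u v w (c + 1) = v := by
  fin_cases c <;> rfl

theorem arrange_prev {α : Type} (c : Fin 3) (u v w : α) : arrange c u v w (c + 2) = w := by
  fin_cases c <;> rfl

theorem secret_eq (c : Fin 3) (x : Fin 3 → Sh m) :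
    secret x = (x c).1 + (x (c + 1)).1 + (x (c + 2)).1 := by
  fin_cases c
  · rfl
  · change (x 0).1 + (x 1).1 + (x 2).1 = (x 1).1 + (x 2).1 + (x 0).1
    ring
  · change (x 0).1 + (x 1).1 + (x 2).1 = (x 2).1 + (x 0).1 + (x 1).1
    ring

theorem consistent_iff (c : Fin 3) (x : Fin 3 → Sh m) :
    Consistent x ↔ (x c).2 = (x (c + 1)).1 ∧ (x (c + 1)).2 = (x (c + 2)).1 ∧
      (x (c + 2)).2 = (x c).1 := by
  have h : c + 1 + 1 = c + 2 := by revert c; decide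
  have h' : c + 2 + 1 = c := by revert c; decide
  constructor
  · intro hx
    refine ⟨hx c, ?_, ?_⟩
    · rw [hx (c + 1), h]
    · rw [hx (c + 2), h']
  · rintro ⟨h₀, h₁, h₂⟩ i
    rcases fin3_cases c i with rfl | rfl | rfl
    · exact h₀
    · rw [h]; exact h₁
    · rw [h']; exact h₂

theorem secret_complete (c : Fin 3) (w : Sh m) (v : ZMod m) : secret (complete c w v) = v := by
  rw [secret_eq c, complete_self, complete_next, complete_prev]
  ring

/-- Party `c` holds two of the three components, and the secret determines the third. -/
theorem complete_of_consistent (c : Fin 3) {x : Fin 3 → Sh m} (h : Consistent x) :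
    x = complete c (x c) (secret x) := by
  rw [consistent_iff c] at h
  apply family_ext c
  · rw [complete_self]
  · rw [complete_next, secret_eq c]
    ext
    · exact h.1.symm
    · simp only [h.1, h.2.1]; ring
  · rw [complete_prev, secret_eq c]
    ext
    · simp only [h.1]; ring
    · exact h.2.2

/-- Each component held by party `c` is also held by one of the other two, so their parts leave it a
single consistent choice. This is the source of robustness against false inputs. -/
theorem consistent_arrange_iff (c : Fin 3) (z w : Sh m) (v : ZMod m) (x : Fin 3 → Sh m)
    (hc : x c = z) (h₁ : x (c + 1) = complete c w v (c + 1))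
    (h₂ : x (c + 2) = complete c w v (c + 2)) : Consistent x ↔ z = w := by
  rw [consistent_iff c, hc, h₁, h₂, complete_next, complete_prev, Prod.ext_iff]
  constructor
  · rintro ⟨h, -, h'⟩
    exact ⟨h'.symm, h⟩
  · rintro ⟨h, h'⟩
    exact ⟨h', rfl, h.symm⟩

theorem complete_add (c : Fin 3) (w w' : Sh m) (v v' : ZMod m) (i : Fin 3) :
    complete c w v i + complete c w' v' i = complete c (w + w') (v + v') i := by
  rcases fin3_cases c i with rfl | rfl | rfl
  · simp only [complete_self]
  · simp only [complete_next]
    ext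
    · simp
    · simp; ring
  · simp only [complete_prev]
    ext
    · simp; ring
    · simp

theorem complete_sub (c : Fin 3) (w w' : Sh m) (v v' : ZMod m) (i : Fin 3) :
    complete c w v i - complete c w' v' i = complete c (w - w') (v - v') i := by
  rcases fin3_cases c i with rfl | rfl | rfl
  · simp only [complete_self]
  · simp only [complete_next]
    ext
    · simp
    · simp; ring
  · simp only [complete_prev]
    ext
    · simp; ring
    · simp

theorem pub_eq_complete (c i : Fin 3) (v : ZMod m) : pub i v = complete c (pub c v) v i := by
  have h : Consistent (fun i => pub i v) := fun i => rfl
  have h' : secret (fun i => pub i v) = v := by simp [secret, pub, held]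
  have := congrFun (complete_of_consistent c h) i
  rwa [h'] at this

/-- Passing from the components `0`, `1` of a sharing of `v` to the components `c`, `c + 1`. -/
def componentsEquiv (c : Fin 3) (v : ZMod m) : Sh m ≃ Sh m where
  toFun r := shareWith r v c
  invFun w := ((complete c w v 0).1, (complete c w v 1).1)
  left_inv r := by
    refine Prod.ext ?_ ?_ <;> fin_cases c <;>
      simp [shareWith, held, complete, arrange] <;> ring
  right_inv w := by
    refine Prod.ext ?_ ?_ <;> fin_cases c <;>
      simp [shareWith, held, complete, arrange] <;> ring

theorem shareWith_eq_complete (c : Fin 3) (r : ZMod m × ZMod m) (v : ZMod m) :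
    shareWith r v = complete c (shareWith r v c) v := by
  have h : Consistent (shareWith r v) := fun i => rfl
  have h' : secret (shareWith r v) = v := by simp [secret, shareWith, held]
  have := complete_of_consistent c h
  rwa [h'] at this

/-- Privacy of the sharing: for fixed `v`, passing from the components `0`, `1` to `c`, `c + 1` is a
bijection, so the part of party `c` is uniform and independent of the secret. -/
theorem randomShares_eq [NeZero m] (c : Fin 3) (v : ZMod m) :
    randomShares v = (PMF.uniformOfFintype (Sh m)).map (fun w => complete c w v) := by
  conv_rhs => rw [← map_uniformOfFintype_equiv (componentsEquiv c v), PMF.map_comp]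
  rw [randomShares]
  congr 1
  funext r
  exact shareWith_eq_complete c r v

theorem randomSharesVec_eq {n : ℕ} [NeZero m] (c : Fin 3) (v : Fin n → ZMod m) :
    randomSharesVec v =
      (PMF.uniformOfFintype (Fin n → Sh m)).map (fun w i j => complete c (w j) (v j) i) := by
  conv_rhs => rw [← map_uniformOfFintype_equiv (Equiv.piCongrRight
    (fun j => componentsEquiv c (v j))), PMF.map_comp]
  rw [randomSharesVec]
  congr 1
  funext r i j
  exact congrFun (shareWith_eq_complete c (r j) (v j)) i

end Complete


/-! ## Joint execution of the honest parties up to indistinguishability -/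

section Execution

variable {ι : Type} {H : ι → Functionality} {M α β γ : Type}

/-- Continue with `p` if nobody has aborted. -/
def proceed (ok : Bool) (p : Oracle (Event H M) (Reaction H M) (Option α × Option β)) :
    Oracle (Event H M) (Reaction H M) (Option α × Option β) :=
  if ok = true then p else .ret (none, none)

/-- Run `p` and, if it succeeds, `q`. -/
def andAlso (p q : Oracle (Event H M) (Reaction H M) Bool) :
    Oracle (Event H M) (Reaction H M) Bool :=
  p.andThen fun ok => if ok = true then q else .ret false

theorem andAlso_proceed (p q : Oracle (Event H M) (Reaction H M) Bool)
    (r : Oracle (Event H M) (Reaction H M) (Option α × Option β)) :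
    (andAlso p q).andThen (fun ok => proceed ok r) =
      p.andThen fun ok => proceed ok (q.andThen fun ok => proceed ok r) := by
  rw [andAlso, Oracle.andThen_assoc]
  congr 1
  funext ok
  cases ok <;> simp [proceed, Oracle.andThen]

theorem Same.proceed {ok : Bool}
    {p q : Oracle (Event H M) (Reaction H M) (Option α × Option β)} (h : Same p q) :
    Same (proceed ok p) (proceed ok q) := by
  cases ok
  · exact Same.refl _
  · exact h

/-- If `p` fails, the coins are unused and vanish by `Same.draw_const`; otherwise they commute with
`p`. -/
theorem Same.draw_proceed (p : Oracle (Event H M) (Reaction H M) Bool) (μ : PMF γ)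
    (k : γ → Oracle (Event H M) (Reaction H M) (Option α × Option β)) :
    Same (p.andThen fun ok => Falcon.proceed ok (.draw μ k))
      (.draw μ fun w => p.andThen fun ok => Falcon.proceed ok (k w)) := by
  refine Same.trans (Same.andThen (Same.refl p)
      (g := fun ok => .draw μ fun w => Falcon.proceed ok (k w)) ?_)
    (Same.draw_andThen μ p _)
  intro ok
  cases ok
  · exact (Same.draw_const μ _).symm
  · exact Same.refl _

open Classical in
/-- The second half of `simCall`, in which the corrupted party has given the input `z`. -/
def simOutput (f : ι) (z₀ : (H f).In) (u : (H f).Out) (z : Option (H f).In) :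
    Oracle (Event H M) (Reaction H M) Bool :=
  if z = some z₀ then .query (.output f (some u)) fun b : Bool => .ret b
  else .query (.output f none) fun _ => .ret false

/-- Interaction with the corrupted party in a call of `H f` in which its correct input is `z₀` and
its output is `u`; the result says whether the call succeeds. -/
def simCall (f : ι) (z₀ : (H f).In) (u : (H f).Out) : Oracle (Event H M) (Reaction H M) Bool :=
  .query (.input f) (simOutput f z₀ u)

theorem simOutput_of_eq {f : ι} {z₀ : (H f).In} {u : (H f).Out} {z : Option (H f).In}
    (h : z = some z₀) : simOutput (M := M) f z₀ u z =
      .query (.output f (some u)) fun b : Bool => .ret b := if_pos h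

theorem simOutput_of_ne {f : ι} {z₀ : (H f).In} {u : (H f).Out} {z : Option (H f).In}
    (h : z ≠ some z₀) : simOutput (M := M) f z₀ u z =
      .query (.output f none) fun _ => .ret false := if_neg h

theorem activate_arrange_none (F : Functionality) (c : Fin 3) (x y : Option F.In) :
    F.activate (arrange c none x y) = PMF.pure none := by
  rw [Functionality.activate, dif_neg]
  intro h
  have := h c
  rw [arrange_self] at this
  cases this

theorem activate_arrange_some (F : Functionality) (c : Fin 3) (z x y : F.In) :
    F.activate (arrange c (some z) (some x) (some y)) = F.eval (arrange c z x y) := by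
  have h : arrange c (some z) (some x) (some y) = fun i => some (arrange c z x y i) := by
    apply family_ext c <;> simp only [arrange_self, arrange_next, arrange_prev]
  rw [h]
  simp [Functionality.activate]

theorem activate_arrange_next_none (F : Functionality) (c : Fin 3) (z y : Option F.In) :
    F.activate (arrange c z none y) = PMF.pure none := by
  rw [Functionality.activate, dif_neg]
  intro h
  have := h (c + 1)
  rw [arrange_next] at this
  cases this

theorem activate_arrange_prev_none (F : Functionality) (c : Fin 3) (z x : Option F.In) :
    F.activate (arrange c z x none) = PMF.pure none := by
  rw [Functionality.activate, dif_neg]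
  intro h
  have := h (c + 2)
  rw [arrange_prev] at this
  cases this

-- The hypothesis on `eval` says that `z₀` is the only input of the corrupted party that does not
-- make the functionality abort. The law `μ` of the output does not depend on what that party
-- submits, so the output can be drawn before the call.
open Classical in
theorem runHonest_call {c : Fin 3} {f : ι} {x y z₀ : (H f).In} {μ : PMF γ}
    {out : γ → Fin 3 → (H f).Out}
    (h : ∀ z, (H f).eval (arrange c z x y) =
      if z = z₀ then μ.map (fun w => some (out w)) else PMF.pure none)
    (k l : (H f).Out → Prog H M α) :
    Same (runHonest c (.call f x k) (.call f y l))
      (.draw μ fun w => (simCall f z₀ (out w c)).andThen fun ok =>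
        proceed ok (runHonest c (k (out w (c + 1))) (l (out w (c + 2))))) := by
  refine Same.trans ?_ (Same.draw_query μ _ _)
  simp only [runHonest, dif_pos, callHybrid, bind, Oracle.ask, Oracle.toss, Oracle.andThen]
  refine Same.query fun z => ?_
  by_cases hz : z = some z₀
  · subst hz
    rw [activate_arrange_some, h, if_pos rfl]
    refine (Same.draw_map _ _ _).trans (Same.draw fun w => ?_)
    rw [simOutput_of_eq rfl]
    refine Same.query fun b => ?_
    cases (b : Bool) <;> exact Same.refl _
  · have : (H f).activate (arrange c z (some x) (some y)) = PMF.pure none := by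
      cases z with
      | none => exact activate_arrange_none _ _ _ _
      | some z =>
        rw [activate_arrange_some, h, if_neg]
        rintro rfl
        exact hz rfl
    rw [this]
    -- A rejected input draws no output in the real call; dummy coins are added to match the
    -- simulation.
    refine (Same.draw_pure _ _).trans ((Same.draw_const μ _).symm.trans (Same.draw fun w => ?_))
    rw [simOutput_of_ne hz]
    refine Same.query fun b => ?_
    cases (b : Bool) <;> exact Same.refl _

/-- Interaction with the corrupted party in a call of `H f` that aborts. -/
def failedCall (f : ι) (a : α) : Oracle (Event H M) (Reaction H M) α :=
  .query (.input f) fun _ => .query (.output f none) fun _ => .ret a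

/-- With one honest party gone the functionality lacks an input and aborts, whatever the corrupted
party submits. -/
theorem runAlone_call (c : Fin 3) (isNext : Bool) (f : ι) (x : (H f).In)
    (k : (H f).Out → Prog H M α) :
    Same (runAlone c isNext (.call f x k)) (failedCall f none) := by
  simp only [runAlone, callHybrid, bind, Oracle.ask, Oracle.toss, Oracle.andThen]
  refine Same.query fun z => ?_
  have : (H f).activate (arrange c z (if isNext = true then some x else none)
      (if isNext = true then none else some x)) = PMF.pure none := by
    cases isNext
    · exact activate_arrange_next_none _ _ _ _
    · exact activate_arrange_prev_none _ _ _ _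
  rw [this]
  exact Same.draw_pure _ _

theorem Prog.andThen_assoc (p : Prog H M α) (f : α → Prog H M β) (g : β → Prog H M γ) :
    (p.andThen f).andThen g = p.andThen (fun a => (f a).andThen g) := by
  induction p with
  | ret a => rfl
  | abort => rfl
  | call f x k ih => simp only [Prog.andThen, ih]
  | exch u v k ih => simp only [Prog.andThen, ih]

end Execution

/-! ## The calls of the functionalities -/

section Calls

variable {ℓ : ℕ} {α β : Type}

/-- Oracle programs interacting with the corrupted party of the Maxpool protocol. -/
abbrev Sim (ℓ : ℕ) (α : Type) : Type 1 :=
  Oracle (Event (hybrid ℓ) (ZMod 2)) (Reaction (hybrid ℓ) (ZMod 2)) α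

open Classical in
theorem eval_FMult (c : Fin 3) (w w' : Sh (2 ^ ℓ)) (v v' : ZMod (2 ^ ℓ)) (z : (FMult ℓ).In) :
    (FMult ℓ).eval (arrange c z (complete c w v (c + 1), complete c w' v' (c + 1))
        (complete c w v (c + 2), complete c w' v' (c + 2))) =
      if z = (w, w') then
        (PMF.uniformOfFintype (Sh (2 ^ ℓ))).map (fun u => some (complete c u (v * v')))
      else PMF.pure none := by
  obtain ⟨z, z'⟩ := z
  set x := arrange c (z, z') (complete c w v (c + 1), complete c w' v' (c + 1))
        (complete c w v (c + 2), complete c w' v' (c + 2)) with hx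
  have h : Consistent (fun i => (x i).1) ↔ z = w :=
    consistent_arrange_iff c z w v _ (by simp only [hx, arrange_self])
      (by simp only [hx, arrange_next]) (by simp only [hx, arrange_prev])
  have h' : Consistent (fun i => (x i).2) ↔ z' = w' :=
    consistent_arrange_iff c z' w' v' _ (by simp only [hx, arrange_self])
      (by simp only [hx, arrange_next]) (by simp only [hx, arrange_prev])
  simp only [FMult]
  rw [h, h']
  by_cases hz : z = w ∧ z' = w'
  · refine Eq.trans ?_ (if_pos (Prod.ext hz.1 hz.2 : (z, z') = (w, w'))).symm
    rw [if_pos hz, randomShares_eq c, PMF.map_comp]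
    have e : (fun i => (x i).1) = complete c w v := by
      apply family_ext c
      · simp only [hx, arrange_self, complete_self, hz.1]
      · simp only [hx, arrange_next]
      · simp only [hx, arrange_prev]
    have e' : (fun i => (x i).2) = complete c w' v' := by
      apply family_ext c
      · simp only [hx, arrange_self, complete_self, hz.2]
      · simp only [hx, arrange_next]
      · simp only [hx, arrange_prev]
    rw [e, e', secret_complete, secret_complete]
    rfl
  · refine (if_neg hz).trans (if_neg fun h : (z, z') = (w, w') => hz ?_).symm
    rwa [Prod.mk.injEq] at h

open Classical in
theorem eval_FDReLU (c : Fin 3) (w : Sh (2 ^ ℓ)) (v : ZMod (2 ^ ℓ)) (z : (FDReLU ℓ).In) :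
    (FDReLU ℓ).eval (arrange c z (complete c w v (c + 1)) (complete c w v (c + 2))) =
      if z = w then
        (PMF.uniformOfFintype (Sh 2)).map (fun u => some (complete c u (dReLU v)))
      else PMF.pure none := by
  let x : Fin 3 → Sh (2 ^ ℓ) := arrange c z (complete c w v (c + 1)) (complete c w v (c + 2))
  have h : Consistent x ↔ z = w :=
    consistent_arrange_iff c z w v _ (arrange_self ..) (arrange_next ..) (arrange_prev ..)
  change (if Consistent x then (randomShares (dReLU (secret x))).map some else PMF.pure none) = _
  by_cases hz : z = w
  · refine Eq.trans ?_ (if_pos hz).symm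
    have e : x = complete c w v :=
      family_ext c ((arrange_self ..).trans (hz.trans (complete_self ..).symm))
        (arrange_next ..) (arrange_prev ..)
    rw [if_pos (h.2 hz), randomShares_eq c, PMF.map_comp, e, secret_complete]
    rfl
  · exact (if_neg (mt h.1 hz)).trans (if_neg hz).symm

/-- Shares of the preprocessed bit `r.1` of which party `c` holds `r.2`. -/
def prepShares (c : Fin 3) (r : ZMod 2 × Sh 2 × Sh (2 ^ ℓ)) (i : Fin 3) : Sh 2 × Sh (2 ^ ℓ) :=
  (complete c r.2.1 r.1 i, complete c r.2.2 (r.1.val : ZMod (2 ^ ℓ)) i)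

/-- The bit and the corrupted party's two parts are merged into one uniform triple, so that the
change of variables from `c` to `b + c` acts on a single draw. -/
theorem eval_FPrep (c : Fin 3) (x : Fin 3 → (FPrep ℓ).In) :
    (FPrep ℓ).eval x = (PMF.uniformOfFintype (ZMod 2 × Sh 2 × Sh (2 ^ ℓ))).map
      (fun r => some (prepShares c r)) := by
  simp only [FPrep, randomShares_eq c]
  rw [uniformOfFintype_prod (β := ZMod 2) (γ := Sh 2 × Sh (2 ^ ℓ)),
    uniformOfFintype_prod (β := Sh 2) (γ := Sh (2 ^ ℓ))]
  simp only [PMF.map_bind, PMF.bind_map, PMF.map_comp]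
  rfl

open Classical in
theorem eval_FMaxpool {n : ℕ} [NeZero n] (c : Fin 3) {x : Fin 3 → Fin n → Sh (2 ^ ℓ)}
    (hx : ∀ j, Consistent (fun i => x i j)) {k : Fin n}
    (hk : k = argmax (fun j => toSigned (secret (fun i => x i j)))) :
    (FMaxpool ℓ n).eval x =
      (PMF.uniformOfFintype (Sh (2 ^ ℓ) × (Fin n → Sh (2 ^ ℓ)))).map fun w => some fun i =>
        (complete c w.1 (secret (fun i => x i k)) i, fun t => complete c (w.2 t) (oneHot k t) i) := by
  simp only [FMaxpool]
  rw [if_pos hx, ← hk, uniformOfFintype_prod, randomShares_eq c, randomSharesVec_eq c]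
  simp only [PMF.map_bind, PMF.bind_map, PMF.map_comp]
  rfl

end Calls


/-! ## Simulation of the protocol -/

section Simulation

variable {ℓ : ℕ} {α β : Type}

/-- The value of `x` or `y` selected by the bit `b`. -/
def selected {γ : Type} (x y : γ) (b : ZMod 2) : γ := if b = 1 then y else x

theorem runHonest_call_abort {c : Fin 3} {f : Cmd} (x : (hybrid ℓ f).In)
    (k : (hybrid ℓ f).Out → Party ℓ α) :
    Same (runHonest c (.call f x k) .abort) (failedCall f (none, none)) := by
  simp only [runHonest, bind]
  exact Same.andThen (runAlone_call c true f x k) fun _ => Same.refl _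

theorem runHonest_abort_call {c : Fin 3} {f : Cmd} (x : (hybrid ℓ f).In)
    (k : (hybrid ℓ f).Out → Party ℓ α) :
    Same (runHonest c .abort (.call f x k)) (failedCall f (none, none)) := by
  simp only [runHonest, bind]
  exact Same.andThen (runAlone_call c false f x k) fun _ => Same.refl _

/-- The honest parties exchange `w.1` and `w.2` with each other, so each can check one message of
the corrupted party. If exactly one check fails, the other honest party goes on alone to its call of
`f`, and the adversary still sees that call fail; if both fail, nothing more happens. The hypotheses
`hk`, `hl` name this next call. -/
theorem runHonest_openBit {c : Fin 3} {f : Cmd} (w : Sh 2) (v : ZMod 2)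
    {k l : ZMod 2 → Party ℓ α} {x y : (hybrid ℓ f).In} {k' l' : (hybrid ℓ f).Out → Party ℓ α}
    (hk : k v = .call f x k') (hl : l v = .call f y l') :
    Same (runHonest c ((openBit (complete c w v (c + 1))).andThen k)
        ((openBit (complete c w v (c + 2))).andThen l))
      (.query (.round (some (v - w.1 - w.2)) (some (v - w.1 - w.2)))
        fun r : Option (ZMod 2) × Option (ZMod 2) =>
          if r.1 = some w.1 ∧ r.2 = some w.2 then runHonest c (k v) (l v)
          else if r.1 = some w.1 ∨ r.2 = some w.2 then failedCall f (none, none)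
          else .ret (none, none)) := by
  simp only [openBit, Prog.andThen, runHonest, bind, Oracle.ask, Oracle.andThen, complete_next,
    complete_prev]
  refine Same.query fun r => ?_
  obtain ⟨r₁, r₂⟩ := (r : Option (ZMod 2) × Option (ZMod 2))
  have e₁ : w.2 + (v - w.1 - w.2) + w.1 = v := by ring
  have e₂ : v - w.1 - w.2 + w.1 + w.2 = v := by ring
  have failNext : Same ((runAlone c true (k v)).andThen fun a => .ret (a, (none : Option α)))
      (failedCall f (none, none)) := by
    rw [hk]
    exact Same.andThen (runAlone_call c true f x k') fun _ => Same.refl _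
  have failPrev : Same ((runAlone c false (l v)).andThen fun b => .ret ((none : Option α), b))
      (failedCall f (none, none)) := by
    rw [hl]
    exact Same.andThen (runAlone_call c false f y l') fun _ => Same.refl _
  have abortNext : Same (runHonest c (k v) .abort) (failedCall f (none, none)) := by
    rw [hk]
    exact runHonest_call_abort x k'
  have abortPrev : Same (runHonest c .abort (l v)) (failedCall f (none, none)) := by
    rw [hl]
    exact runHonest_abort_call y l'
  have abortBoth : runHonest c (.abort : Party ℓ α) .abort = .ret (none, none) := by
    simp [runHonest, runAlone, bind, Oracle.andThen]
  cases r₁ with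
  | none =>
    cases r₂ with
    | none => simpa using Same.refl _
    | some s =>
      by_cases hs : s = w.2
      · simpa [hs, Prog.andThen, e₂] using failPrev
      · simpa [hs, Prog.andThen, runAlone, Oracle.andThen] using Same.refl _
  | some t =>
    by_cases ht : t = w.1
    · cases r₂ with
      | none => simpa [ht, Prog.andThen, e₁] using failNext
      | some s =>
        by_cases hs : s = w.2
        · simpa [ht, hs, Prog.andThen, e₁, e₂] using Same.refl _
        · simpa [ht, hs, Prog.andThen, e₁] using abortNext
    · cases r₂ with
      | none =>
        simpa [ht, Ne.symm ht, Prog.andThen, runAlone, Oracle.andThen] using Same.refl _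
      | some s =>
        by_cases hs : s = w.2
        · simpa [ht, Ne.symm ht, hs, Prog.andThen, e₂] using abortPrev
        · simpa [ht, Ne.symm ht, hs, Prog.andThen, abortBoth] using Same.refl _

/-- The interaction of the simulator with the corrupted party when a bit of which that party holds
`w`, with third component `t`, is opened, and `p` is run thereafter; the honest parties call `f`
after the opening. -/
def simOpen (f : Cmd) (w : Sh 2) (t : ZMod 2) (p : Sim ℓ Bool) : Sim ℓ Bool :=
  .query (.round (some t) (some t)) fun r : Option (ZMod 2) × Option (ZMod 2) =>
    if r.1 = some w.1 ∧ r.2 = some w.2 then p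
    else if r.1 = some w.1 ∨ r.2 = some w.2 then failedCall f false
    else .ret false

/-- The part of the corrupted party in the sharing of the bit `1 - c` or `c`. -/
def flipped (i : Fin 3) (e : ZMod 2) (w : Sh (2 ^ ℓ)) : Sh (2 ^ ℓ) :=
  if e = 1 then pub i 1 - w else w

/-- Simulation of `selectShares`: the corrupted party holds `wx`, `wy`, `wb` before and `w`
thereafter. -/
def simSelect (c : Fin 3) (wx wy : Sh (2 ^ ℓ)) (wb : Sh 2) (w : Sh (2 ^ ℓ)) : Sim ℓ Bool :=
  .draw (PMF.uniformOfFintype (ZMod 2 × Sh 2 × Sh (2 ^ ℓ))) fun r =>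
    andAlso (simCall (H := hybrid ℓ) Cmd.prep () r.2)
      (simOpen Cmd.mult (wb + r.2.1) (r.1 - (wb + r.2.1).1 - (wb + r.2.1).2)
        (simCall (H := hybrid ℓ) Cmd.mult (wy - wx, flipped c r.1 r.2.2) (w - wx)))

theorem selectShares_andThen (i : Fin 3) (x y : Sh (2 ^ ℓ)) (b : Sh 2)
    (f : Sh (2 ^ ℓ) → Party ℓ α) :
    (selectShares i x y b).andThen f =
      Prog.call (H := hybrid ℓ) Cmd.prep () fun c : Sh 2 × Sh (2 ^ ℓ) =>
        (openBit (b + c.1)).andThen fun e =>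
          Prog.call (H := hybrid ℓ) Cmd.mult (y - x, flipped i e c.2)
            fun z : Sh (2 ^ ℓ) => f (z + x) := by
  simp only [selectShares, prep, mult, bind, Prog.andThen, Prog.andThen_assoc, flipped]
  rfl

theorem flipped_complete (c i : Fin 3) (e : ZMod 2) (w : Sh (2 ^ ℓ)) (v : ZMod (2 ^ ℓ)) :
    flipped i e (complete c w v i) =
      complete c (flipped c e w) (if e = 1 then 1 - v else v) i := by
  unfold flipped
  split_ifs
  · rw [pub_eq_complete c i, complete_sub]
  · rfl

/-- Undoing the mask: flipping `c` exactly when `b ⊕ c = 1` gives `b`, now as a residue modulo `2 ^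
ℓ`. -/
theorem flipped_value (b c : ZMod 2) :
    (if b + c = 1 then 1 - (c.val : ZMod (2 ^ ℓ)) else c.val) = selected 0 1 b := by
  have h : ∀ x : ZMod 2, x = 0 ∨ x = 1 := by decide
  rcases h b with rfl | rfl <;> rcases h c with rfl | rfl
  all_goals simp [selected, ZMod.val_one]

theorem mul_selected_add {R : Type} [CommRing R] (x y : R) (b : ZMod 2) :
    (y - x) * selected 0 1 b + x = selected x y b := by
  unfold selected
  split_ifs <;> ring

theorem runHonest_selectShares (c : Fin 3) (wx wy : Sh (2 ^ ℓ)) (vx vy : ZMod (2 ^ ℓ)) (wb : Sh 2)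
    (vb : ZMod 2) (f g : Sh (2 ^ ℓ) → Party ℓ α) :
    Same (runHonest c
        ((selectShares (c + 1) (complete c wx vx (c + 1)) (complete c wy vy (c + 1))
          (complete c wb vb (c + 1))).andThen f)
        ((selectShares (c + 2) (complete c wx vx (c + 2)) (complete c wy vy (c + 2))
          (complete c wb vb (c + 2))).andThen g))
      (.draw (PMF.uniformOfFintype (Sh (2 ^ ℓ))) fun w =>
        (simSelect c wx wy wb w).andThen fun ok => proceed ok
          (runHonest c (f (complete c w (selected vx vy vb) (c + 1)))
            (g (complete c w (selected vx vy vb) (c + 2))))) := by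
  rw [selectShares_andThen, selectShares_andThen]
  refine (runHonest_call (H := hybrid ℓ) (f := Cmd.prep) (z₀ := ()) (out := prepShares c)
    (μ := PMF.uniformOfFintype (ZMod 2 × Sh 2 × Sh (2 ^ ℓ))) ?_ _ _).trans ?_
  · intro z
    exact (eval_FPrep c _).trans (if_pos rfl).symm
  have hprep : ∀ r : ZMod 2 × Sh 2 × Sh (2 ^ ℓ), prepShares c r c = r.2 := by
    intro r
    simp only [prepShares, complete_self]
  -- On the simulated side the final part `w` is drawn first; it is moved inwards, past the call of
  -- `Cmd.prep` and the opening, to the multiplication that produces it.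
  refine Same.trans ?_ (Same.draw_comm _ _ _)
  -- One-time pad: the simulator's uniform `e` is substituted by `vb + c`.
  refine Same.trans ?_ (Same.draw_equiv ((Equiv.addLeft vb).prodCongr (Equiv.refl _)) _)
  refine Same.draw fun r => ?_
  simp only [andAlso_proceed]
  refine Same.trans ?_ (Same.draw_proceed _ _ _)
  rw [hprep]
  refine Same.andThen (Same.refl _) fun ok => Same.proceed ?_
  simp only [prepShares, complete_add, complete_sub]
  refine (runHonest_openBit (f := Cmd.mult) _ _ rfl rfl).trans ?_
  refine Same.trans ?_ (Same.draw_query _ _ _)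
  refine Same.query fun q => ?_
  simp only [flipped_complete, flipped_value]
  have hr : (Equiv.addLeft vb).prodCongr (Equiv.refl (Sh 2 × Sh (2 ^ ℓ))) r = (vb + r.1, r.2) := rfl
  simp only [hr]
  obtain ⟨q₁, q₂⟩ := (q : Option (ZMod 2) × Option (ZMod 2))
  split_ifs with h₁ h₂
  · refine (runHonest_call (H := hybrid ℓ) (f := Cmd.mult) (fun z => eval_FMult c _ _ _ _ z)
      _ _).trans ?_
    -- The product part `u` is uniform, hence so is the final part `w = u + wx`.
    refine Same.trans ?_ (Same.draw_equiv (Equiv.addRight wx) _)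
    refine Same.draw fun u => ?_
    simp only [complete_self, complete_add, mul_selected_add, Equiv.coe_addRight,
      add_sub_cancel_right]
    exact Same.refl _
  · exact (Same.draw_const _ _).symm
  · exact (Same.draw_const _ _).symm

/-- Simulation of a family of instances of `selectShares`. -/
def simSelects (c : Fin 3) (wb : Sh 2) :
    (n : ℕ) → (wx wy w : Fin n → Sh (2 ^ ℓ)) → Sim ℓ Bool
  | 0, _, _, _ => .ret true
  | n + 1, wx, wy, w =>
      andAlso (simSelect c (wx 0) (wy 0) wb (w 0))
        (simSelects c wb n (fun t => wx t.succ) (fun t => wy t.succ) (fun t => w t.succ))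

theorem runHonest_selectShares_forFin (c : Fin 3) (wb : Sh 2) (vb : ZMod 2) (n : ℕ)
    (wx wy : Fin n → Sh (2 ^ ℓ)) (vx vy : Fin n → ZMod (2 ^ ℓ))
    (f g : (Fin n → Sh (2 ^ ℓ)) → Party ℓ α) :
    Same (runHonest c
        ((Prog.forFin n fun t => selectShares (c + 1) (complete c (wx t) (vx t) (c + 1))
          (complete c (wy t) (vy t) (c + 1)) (complete c wb vb (c + 1))).andThen f)
        ((Prog.forFin n fun t => selectShares (c + 2) (complete c (wx t) (vx t) (c + 2))
          (complete c (wy t) (vy t) (c + 2)) (complete c wb vb (c + 2))).andThen g))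
      (.draw (PMF.uniformOfFintype (Fin n → Sh (2 ^ ℓ))) fun w =>
        (simSelects c wb n wx wy w).andThen fun ok => proceed ok
          (runHonest c (f fun t => complete c (w t) (selected (vx t) (vy t) vb) (c + 1))
            (g fun t => complete c (w t) (selected (vx t) (vy t) vb) (c + 2)))) := by
  induction n with
  | zero =>
    -- There is nothing to select; the draw of the empty vector is a dummy.
    refine (Same.draw_const (PMF.uniformOfFintype (Fin 0 → Sh (2 ^ ℓ))) _).symm.trans
      (Same.draw fun w => Same.of_eq ?_)
    simp only [Prog.forFin, Prog.andThen, simSelects, Oracle.andThen, proceed, if_true]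
    congr 2 <;> exact Subsingleton.elim _ _
  | succ n ih =>
    simp only [Prog.forFin, bind, Prog.andThen_assoc]
    refine (runHonest_selectShares c _ _ _ _ _ _ _ _).trans ?_
    refine Same.trans ?_ (Same.draw_cons _).symm
    refine Same.draw fun w₀ => ?_
    have e : ∀ w, simSelects c wb (n + 1) wx wy (Fin.cons w₀ w) =
        andAlso (simSelect c (wx 0) (wy 0) wb w₀)
          (simSelects c wb n (fun t => wx t.succ) (fun t => wy t.succ) w) := fun _ => rfl
    simp only [e, andAlso_proceed]
    refine Same.trans ?_ (Same.draw_proceed _ _ _)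
    refine Same.andThen (Same.refl _) fun ok => Same.proceed ?_
    refine (ih _ _ _ _ _ _).trans (Same.draw fun w => Same.of_eq ?_)
    congr 1
    funext ok
    congr 2
    · simp only [Prog.andThen]
      congr 1
      funext t
      cases t using Fin.cases <;> rfl
    · simp only [Prog.andThen]
      congr 1
      funext t
      cases t using Fin.cases <;> rfl

end Simulation


/-! ### Simulation of the loop with prescribed final parts -/

section Loop

variable {ℓ n : ℕ}

/-- The values computed by the loop of the Maxpool protocol. -/
def loopValue (a : Fin n → ZMod (2 ^ ℓ)) :
    List (Fin n) → ZMod (2 ^ ℓ) → (Fin n → ZMod (2 ^ ℓ)) → ZMod (2 ^ ℓ) × (Fin n → ZMod (2 ^ ℓ))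
  | [], max, ind => (max, ind)
  | j :: js, max, ind =>
      loopValue a js (selected (a j) max (dReLU (max - a j)))
        (fun t => selected (oneHot j t) (ind t) (dReLU (max - a j)))

/-- What the corrupted party holds of the sharings of the maximum and of the one-hot vector. -/
abbrev Held (ℓ n : ℕ) : Type := Sh (2 ^ ℓ) × (Fin n → Sh (2 ^ ℓ))

/-- Sharings of `v` of which party `c` holds `w`, as seen by party `i`. -/
def completeVec (c : Fin 3) (w : Held ℓ n) (v : ZMod (2 ^ ℓ) × (Fin n → ZMod (2 ^ ℓ))) (i : Fin 3) :
    Held ℓ n :=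
  (complete c w.1 v.1 i, fun t => complete c (w.2 t) (v.2 t) i)

/-- Simulation of one round of the loop from the state `w` to the state `w'`. -/
def simRound (c : Fin 3) (wa : Fin n → Sh (2 ^ ℓ)) (j : Fin n) (u : Sh 2) (w w' : Held ℓ n)
    (p : Sim ℓ Bool) : Sim ℓ Bool :=
  andAlso (simCall (H := hybrid ℓ) Cmd.drelu (w.1 - wa j) u)
    (andAlso (simSelect c (wa j) w.1 u w'.1)
      (andAlso (simSelects c u n (fun t => pub c (oneHot j t)) w.2 w'.2) p))

/-- Simulation of the loop; the corrupted party holds `w` before and `w'` thereafter. -/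
def simLoop (c : Fin 3) (wa : Fin n → Sh (2 ^ ℓ)) :
    List (Fin n) → (w w' : Held ℓ n) → Sim ℓ Bool
  | [], _, _ => .ret true
  -- The last round has to end in the given `w'`; only intermediate states are drawn by the
  -- simulator.
  | [j], w, w' => .draw (PMF.uniformOfFintype (Sh 2)) fun u => simRound c wa j u w w' (.ret true)
  | j :: j' :: js, w, w' =>
      .draw (PMF.uniformOfFintype (Sh 2)) fun u =>
        .draw (PMF.uniformOfFintype (Held ℓ n)) fun w₁ =>
          simRound c wa j u w w₁ (simLoop c wa (j' :: js) w₁ w')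

theorem runHonest_round {α : Type} (c : Fin 3) (wa : Fin n → Sh (2 ^ ℓ))
    (a : Fin n → ZMod (2 ^ ℓ)) (j : Fin n) (w : Held ℓ n)
    (v : ZMod (2 ^ ℓ) × (Fin n → ZMod (2 ^ ℓ))) (f : Fin 3 → Held ℓ n → Party ℓ α) :
    Same (runHonest c
        ((drelu ((completeVec c w v (c + 1)).1 - complete c (wa j) (a j) (c + 1))).andThen fun b =>
          (selectShares (c + 1) (complete c (wa j) (a j) (c + 1)) (completeVec c w v (c + 1)).1
            b).andThen fun max =>
            (Prog.forFin n fun t => selectShares (c + 1) (pub (c + 1) (oneHot j t))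
              ((completeVec c w v (c + 1)).2 t) b).andThen fun ind => f (c + 1) (max, ind))
        ((drelu ((completeVec c w v (c + 2)).1 - complete c (wa j) (a j) (c + 2))).andThen fun b =>
          (selectShares (c + 2) (complete c (wa j) (a j) (c + 2)) (completeVec c w v (c + 2)).1
            b).andThen fun max =>
            (Prog.forFin n fun t => selectShares (c + 2) (pub (c + 2) (oneHot j t))
              ((completeVec c w v (c + 2)).2 t) b).andThen fun ind => f (c + 2) (max, ind)))
      (.draw (PMF.uniformOfFintype (Sh 2)) fun u =>
        .draw (PMF.uniformOfFintype (Held ℓ n)) fun w' =>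
          (simRound c wa j u w w' (.ret true)).andThen fun ok => proceed ok
            (runHonest c
              (f (c + 1) (completeVec c w' (selected (a j) v.1 (dReLU (v.1 - a j)),
                fun t => selected (oneHot j t) (v.2 t) (dReLU (v.1 - a j))) (c + 1)))
              (f (c + 2) (completeVec c w' (selected (a j) v.1 (dReLU (v.1 - a j)),
                fun t => selected (oneHot j t) (v.2 t) (dReLU (v.1 - a j))) (c + 2))))) := by
  simp only [completeVec, complete_sub, drelu, Prog.andThen]
  refine (runHonest_call (H := hybrid ℓ) (f := Cmd.drelu) (fun z => eval_FDReLU c _ _ z)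
      _ _).trans (Same.draw fun u => ?_)
  simp only [complete_self, simRound, andAlso_proceed]
  refine Same.trans ?_ (Same.draw_proceed _ _ _)
  refine Same.andThen (Same.refl _) fun ok => Same.proceed ?_
  -- The new state splits into the part for the maximum and the parts for the one-hot vector; the
  -- latter are drawn only after the maximum has been selected.
  refine Same.trans ?_ (Same.draw_prod _).symm
  refine (runHonest_selectShares c _ _ _ _ _ _ _ _).trans (Same.draw fun w₁ => ?_)
  dsimp only
  refine Same.trans ?_ (Same.draw_proceed _ _ _)
  refine Same.andThen (Same.refl _) fun ok => Same.proceed ?_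
  simp only [pub_eq_complete c (c + 1), pub_eq_complete c (c + 2)]
  refine (runHonest_selectShares_forFin c _ _ _ _ _ _ _ _ _).trans (Same.draw fun w₂ => ?_)
  refine Same.andThen (Same.refl _) fun ok => Same.proceed ?_
  simp only [Oracle.andThen, proceed, if_true]
  exact Same.refl _

theorem simRound_proceed {α β : Type} (c : Fin 3) (wa : Fin n → Sh (2 ^ ℓ)) (j : Fin n) (u : Sh 2)
    (w w' : Held ℓ n) (p : Sim ℓ Bool) (r : Sim ℓ (Option α × Option β)) :
    (simRound c wa j u w w' p).andThen (fun ok => proceed ok r) =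
      (simRound c wa j u w w' (.ret true)).andThen fun ok => proceed ok
        (p.andThen fun ok => proceed ok r) := by
  simp only [simRound, andAlso_proceed]
  simp only [Oracle.andThen, proceed, if_true]

/-- Every round rerandomizes the whole state, so after at least one round the corrupted party's
parts are uniform and can be drawn first. An empty list is excluded because the output would then be
the initial, not freshly shared, state. -/
theorem runHonest_maxpoolLoop (c : Fin 3) (wa : Fin n → Sh (2 ^ ℓ)) (a : Fin n → ZMod (2 ^ ℓ))
    (js : List (Fin n)) (hjs : js ≠ []) (w : Held ℓ n)
    (v : ZMod (2 ^ ℓ) × (Fin n → ZMod (2 ^ ℓ))) :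
    Same (runHonest c
        (maxpoolLoop (c + 1) (fun j => complete c (wa j) (a j) (c + 1)) js
          (completeVec c w v (c + 1)).1 (completeVec c w v (c + 1)).2)
        (maxpoolLoop (c + 2) (fun j => complete c (wa j) (a j) (c + 2)) js
          (completeVec c w v (c + 2)).1 (completeVec c w v (c + 2)).2))
      (.draw (PMF.uniformOfFintype (Held ℓ n)) fun w' =>
        (simLoop c wa js w w').andThen fun ok => proceed ok
          (.ret (some (completeVec c w' (loopValue a js v.1 v.2) (c + 1)),
            some (completeVec c w' (loopValue a js v.1 v.2) (c + 2))))) := by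
  induction js generalizing w v with
  | nil => exact absurd rfl hjs
  | cons j js ih =>
    refine (runHonest_round c wa a j w v fun i s =>
      maxpoolLoop i (fun j => complete c (wa j) (a j) i) js s.1 s.2).trans ?_
    cases js with
    | nil =>
      refine (Same.draw_comm _ _ _).trans (Same.draw fun w' => ?_)
      refine Same.draw fun u => Same.andThen (Same.refl _) fun ok => Same.proceed ?_
      simp only [maxpoolLoop, runHonest, runAlone, bind, Oracle.andThen]
      exact Same.refl _
    | cons j' js =>
      refine Same.trans ?_ (Same.draw_comm _ _ _)
      refine Same.draw fun u => ?_
      refine Same.trans ?_ (Same.draw_comm _ _ _)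
      refine Same.draw fun w₁ => ?_
      simp only [simRound_proceed _ _ _ _ _ _ (simLoop _ _ _ _ _)]
      refine Same.trans ?_ (Same.draw_proceed _ _ _)
      refine Same.andThen (Same.refl _) fun ok => Same.proceed ?_
      exact ih (List.cons_ne_nil _ _) w₁ _

end Loop


/-! ## The values computed by the loop -/

section Values

variable {ℓ n : ℕ}

/-- The integer difference of the signed values lies strictly within the signed range, so it is the
signed value of the residue `a - b`, whose sign `dReLU` reads off. -/
theorem dReLU_sub {a b : ZMod (2 ^ ℓ)} (hl : 1 ≤ ℓ)
    (h : |toSigned a - toSigned b| < 2 ^ (ℓ - 1)) :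
    dReLU (a - b) = if toSigned b ≤ toSigned a then 1 else 0 := by
  obtain ⟨k, rfl⟩ : ∃ k, ℓ = k + 1 := ⟨ℓ - 1, by omega⟩
  have hsum : a.val = ((a - b).val + b.val) % 2 ^ (k + 1) := by
    rw [← ZMod.val_add, sub_add_cancel]
  have ha := ZMod.val_lt a
  have hb := ZMod.val_lt b
  have hab := ZMod.val_lt (a - b)
  simp only [Nat.add_sub_cancel, toSigned, dReLU, abs_lt] at *
  generalize (a - b).val = s at *
  generalize a.val = x at *
  generalize b.val = y at *
  have hpow : 2 ^ (k + 1) = 2 * 2 ^ k := by ring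
  have hpow' : (2 : ℤ) ^ (k + 1) = 2 * (2 ^ k : ℕ) := by push_cast; ring
  have hpow'' : (2 : ℤ) ^ k = (2 ^ k : ℕ) := by push_cast; rfl
  rw [hpow'] at *
  rw [hpow''] at h
  rw [hpow] at ha hb hab hsum
  generalize 2 ^ k = N at *
  -- The sum of two residues wraps around at most once. With `N` for `2 ^ k`, everything becomes
  -- linear arithmetic.
  have hsum' : x = s + y ∨ x + 2 * N = s + y := by
    rcases lt_or_ge (s + y) (2 * N) with hlt | hge
    · left
      rwa [Nat.mod_eq_of_lt hlt] at hsum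
    · right
      rw [Nat.mod_eq_sub_mod hge, Nat.mod_eq_of_lt (by omega)] at hsum
      omega
  clear hsum
  congr 1
  rw [eq_iff_iff]
  split_ifs at h ⊢ <;> omega

/-- The position of the maximum according to the comparisons of the loop. -/
def scan (a : Fin n → ℤ) (k : Fin n) (js : List (Fin n)) : Fin n :=
  js.foldl (fun k j => if a j ≤ a k then k else j) k

/-- Positions are visited in increasing order and a tie keeps the current one, so the result is the
smallest maximizer. -/
theorem scan_spec (a : Fin n → ℤ) (js : List (Fin n)) (k : Fin n)
    (h : (k :: js).Pairwise (· < ·)) :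
    scan a k js ∈ k :: js ∧ ∀ j ∈ k :: js, a j ≤ a (scan a k js) ∧
      (a j = a (scan a k js) → scan a k js ≤ j) := by
  induction js generalizing k with
  | nil => simp [scan]
  | cons i js ih =>
    simp only [List.pairwise_cons, List.mem_cons, forall_eq_or_imp] at h
    obtain ⟨⟨hki, hk⟩, hi, hjs⟩ := h
    have e : scan a k (i :: js) = scan a (if a i ≤ a k then k else i) js := rfl
    rw [e]
    split_ifs with hik
    · obtain ⟨h₁, h₂⟩ := ih k (List.pairwise_cons.2 ⟨hk, hjs⟩)
      refine ⟨?_, ?_⟩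
      · simp only [List.mem_cons] at h₁ ⊢
        tauto
      · simp only [List.mem_cons, forall_eq_or_imp] at h₂ ⊢
        refine ⟨h₂.1, ⟨hik.trans h₂.1.1, fun he => ?_⟩, h₂.2⟩
        -- If the discarded `i` attains the maximum, then so does `k`, because `a i ≤ a k`; hence
        -- the result is at most `k`, which precedes `i`.
        exact (h₂.1.2 (le_antisymm h₂.1.1 (he ▸ hik))).trans hki.le
    · obtain ⟨h₁, h₂⟩ := ih i (List.pairwise_cons.2 ⟨hi, hjs⟩)
      refine ⟨List.mem_cons_of_mem _ h₁, ?_⟩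
      intro j hj
      rcases List.mem_cons.1 hj with rfl | hj
      -- The replaced position has a value strictly below `a i`, so it cannot tie with the maximum.
      · have := h₂ i List.mem_cons_self
        exact ⟨by omega, fun he => by omega⟩
      · exact h₂ j hj

theorem argmax_eq_of [NeZero n] {a : Fin n → ℤ} {k : Fin n}
    (h : ∀ j, a j ≤ a k ∧ (a j = a k → k ≤ j)) : argmax a = k := by
  have hk : k ∈ maximizers a := by simpa [maximizers] using fun j => (h j).1
  refine le_antisymm (Finset.min'_le _ _ hk) (Finset.le_min' _ _ _ fun j hj => ?_)
  simp only [maximizers, Finset.mem_filter, Finset.mem_univ, true_and] at hj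
  exact (h j).2 (le_antisymm (h j).1 (hj k))

theorem zero_cons_tail_finRange [NeZero n] : (0 : Fin n) :: (List.finRange n).tail =
    List.finRange n := by
  obtain ⟨m, rfl⟩ := Nat.exists_eq_succ_of_ne_zero (NeZero.ne n)
  rw [List.finRange_succ]
  rfl

theorem scan_eq_argmax [NeZero n] (a : Fin n → ℤ) :
    scan a 0 (List.finRange n).tail = argmax a := by
  have h := scan_spec a (List.finRange n).tail 0
    (by rw [zero_cons_tail_finRange]; exact List.pairwise_lt_finRange n)
  rw [zero_cons_tail_finRange] at h
  exact (argmax_eq_of fun j => h.2 j (List.mem_finRange j)).symm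

/-- The loop invariant: the state always has the form `(a k, oneHot k)`, and one round updates `k`
exactly as `scan` does. -/
theorem loopValue_eq {a : Fin n → ZMod (2 ^ ℓ)} (hl : 1 ≤ ℓ)
    (h : ∀ j k, |toSigned (a j) - toSigned (a k)| < 2 ^ (ℓ - 1)) (js : List (Fin n)) (k : Fin n) :
    loopValue a js (a k) (oneHot k) =
      (a (scan (fun j => toSigned (a j)) k js), oneHot (scan (fun j => toSigned (a j)) k js)) := by
  induction js generalizing k with
  | nil => rfl
  | cons j js ih =>
    have e : scan (fun j => toSigned (a j)) k (j :: js) =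
      scan (fun j => toSigned (a j)) (if toSigned (a j) ≤ toSigned (a k) then k else j) js := rfl
    rw [e, loopValue, dReLU_sub hl (h k j)]
    split_ifs with hjk
    · exact ih k
    · exact ih j

end Values

/-! ## Security of the Maxpool protocol -/

/-- The simulator for the Maxpool protocol with corrupted party `c`. -/
def maxpoolSimulator (ℓ n : ℕ) [NeZero n] (c : Fin 3) :
    Simulator (hybrid ℓ) (ZMod 2) (FMaxpool ℓ n) where
  Memory := Fin n → Sh (2 ^ ℓ)
  -- The prescribed input is submitted before any interaction; a later deviation only turns the
  -- delivery decision into an abort.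
  choose x := .ret (some x, x)
  finish wa out :=
    match (out : Option (Held ℓ n)) with
    | none => .ret false
    | some w => simLoop c wa (List.finRange n).tail (wa 0, fun t => pub c (oneHot 0 t)) w

/-- The execution in which the output parts `w` of the corrupted party are drawn first. -/
def simulatedExec {ℓ n : ℕ} [NeZero n] (c : Fin 3) (x : Fin 3 → Fin n → Sh (2 ^ ℓ)) (k : Fin n) :
    Sim ℓ (Option (Held ℓ n) × Option (Held ℓ n)) :=
  .draw (PMF.uniformOfFintype (Held ℓ n)) fun w =>
    (simLoop c (x c) (List.finRange n).tail (x c 0, fun t => pub c (oneHot 0 t)) w).andThen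
      fun ok => proceed ok
        (.ret (some (completeVec c w (secret fun i => x i k, oneHot k) (c + 1)),
          some (completeVec c w (secret fun i => x i k, oneHot k) (c + 2))))

theorem runHonest_maxpool {ℓ n : ℕ} [NeZero n] (hl : 1 ≤ ℓ) (hn : 2 ≤ n) (c : Fin 3)
    {x : Fin 3 → Fin n → Sh (2 ^ ℓ)} (hx : Admissible x) :
    Same (runHonest c (maxpool (c + 1) (x (c + 1))) (maxpool (c + 2) (x (c + 2))))
      (simulatedExec c x (argmax fun j => toSigned (secret fun i => x i j))) := by
  obtain ⟨hcons, hdiff⟩ := hx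
  -- This is where `2 ≤ n` enters: at least one round takes place.
  have hne : (List.finRange n).tail ≠ [] := by
    intro h
    have := congrArg List.length h
    rw [List.length_tail, List.length_finRange, List.length_nil] at this
    omega
  have key := runHonest_maxpoolLoop c (x c) (fun j => secret fun i => x i j)
    (List.finRange n).tail hne (x c 0, fun t => pub c (oneHot 0 t))
    (secret fun i => x i 0, oneHot 0)
  rw [loopValue_eq (a := fun j => secret fun i => x i j) hl hdiff, scan_eq_argmax] at key
  refine Same.trans (Same.of_eq ?_) key
  have e : ∀ i j, x i j = complete c (x c j) (secret fun i => x i j) i := fun i j =>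
    congrFun (complete_of_consistent c (hcons j)) i
  simp only [maxpool, completeVec, ← pub_eq_complete c, ← e]

/-- The functionality draws the corrupted party's parts, and the result of `simLoop` is the decision
on delivery. Only consistency of the inputs matters here; absence of overflow is needed for the real
execution alone. -/
theorem idealExec_maxpool {ℓ n : ℕ} [NeZero n] (c : Fin 3)
    {x : Fin 3 → Fin n → Sh (2 ^ ℓ)} (hx : ∀ j, Consistent fun i => x i j) :
    Same (idealExec (maxpoolSimulator ℓ n c) c x)
      (simulatedExec c x (argmax fun j => toSigned (secret fun i => x i j))) := by
  have hact : (FMaxpool ℓ n).activate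
      (arrange c (some (x c)) (some (x (c + 1))) (some (x (c + 2)))) =
      (PMF.uniformOfFintype (Held ℓ n)).map fun w => some (completeVec c w
        (secret fun i => x i (argmax fun j => toSigned (secret fun i => x i j)),
          oneHot (argmax fun j => toSigned (secret fun i => x i j)))) := by
    refine (activate_arrange_some (FMaxpool ℓ n) c (x c) _ _).trans ?_
    have hax : arrange c (x c) (x (c + 1)) (x (c + 2)) = x := by
      apply family_ext c
      · rw [arrange_self]
      · rw [arrange_next]
      · rw [arrange_prev]
    exact (congrArg (FMaxpool ℓ n).eval hax).trans (eval_FMaxpool c hx rfl)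
  simp only [idealExec, maxpoolSimulator, bind, Oracle.andThen, Oracle.toss]
  rw [hact]
  refine (Same.draw_map _ _ _).trans (Same.draw fun w => ?_)
  refine Same.andThen (Same.of_eq ?_) fun ok => ?_
  · change simLoop c (x c) _ _ (completeVec c w _ c) = _
    simp only [completeVec, complete_self]
  · cases ok <;> exact Same.refl _

end Falcon

end

theorem theorem4 (ℓ n : ℕ) [NeZero n] (hl : 1 ≤ ℓ) (hn : 2 ≤ n) :
    Falcon.SecurelyRealizesWithAbort (H := Falcon.hybrid ℓ) (M := ZMod 2)
      (Falcon.FMaxpool ℓ n) Falcon.maxpool Falcon.Admissible := fun c =>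
  ⟨Falcon.maxpoolSimulator ℓ n c, fun _ hx A =>
    ((Falcon.runHonest_maxpool hl hn c hx).trans (Falcon.idealExec_maxpool c hx.1).symm) _ A _⟩
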